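/- Fix an integer $d\ge 2$. A $d$-ary tree is a rooted tree in which every internal (non-leaf) vertex has at least two and at most $d$ children; trees are considered up to root-preserving isomorphism, and $\|T\|$ denotes the number of leaves of $T$. The empty tree, with $0$ leaves, is also allowed. A set $S$ of leaves of $T$ induces a $d$-ary tree: take the smallest subtree of $T$ containing $S$ and repeatedly suppress vertices with exactly one child (the empty set induces the empty tree). Let $c(D,T)$ be the number of sets of leaves of $T$ that induce a tree isomorphic to $D$, let $\gamma(D,T)=c(D,T)/\binom{\|T\|}{\|D\|}$, and let $$I_d(D)=\limsup_{n\to\infty}\ \max_{\substack{\|T\|=n\\ T\ d\text{-ary tree}}}\gamma(D,T)$$ be the $d$-ary inducibility of $D$ (so $I_d(D)=1$ if $D$ is empty). Let $D$ be a $d$-ary tree and let $D_1,\dots,D_d$ be its branches, i.e. the components that remain when the root is removed, padded with empty trees so that there are exactly $d$ of them (if $D$ is empty or a single vertex, all of them are empty). Call two permutations $\pi,\pi'$ of $\{1,\dots,d\}$ equivalent if $D_{\pi(j)}$ is isomorphic to $D_{\pi'(j)}$ as a rooted tree for every $j$, and let $|M(D)|$ be the number of equivalence classes. For $j\ge 0$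 let $m_j$ be the number of indices $i\in\{1,\dots,d\}$ with $\|D_i\|=j$ (empty branches are counted in $m_0$). Then $$I_d(D)\le\frac{|M(D)|\prod_{j\ge 0}m_j!}{d!}\prod_{i=1}^d I_d(D_i).$$ If any two branches $D_i,D_j$ with the same number of leaves are isomorphic, then $\frac{|M(D)|\prod_{j\ge 0}m_j!}{d!}=1$, so that this reduces to $$I_d(D)\le\prod_{i=1}^d I_d(D_i).$$ -/

import Mathlib

open scoped Nat

/-- Rooted trees in which every vertex has `d` slots for branches, a slot being allowed to hold the
empty tree `nil`.  `leaf` is the tree with a single vertex; `node b` has a root whose branches are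
`b 0, …, b (d - 1)`.  The order of the slots carries no meaning: trees are compared by `RTree.Iso`. -/
inductive RTree (d : ℕ) : Type
  | nil : RTree d
  | leaf : RTree d
  | node (b : Fin d → RTree d) : RTree d

namespace RTree

variable {d : ℕ}

/-- A `d`-ary tree (possibly empty): every internal vertex has at least two (and, by construction,
at most `d`) children, that is, nonempty branches. -/
def IsDary : RTree d → Prop
  | nil => True
  | leaf => True
  | node b => 2 ≤ {i | b i ≠ nil}.ncard ∧ ∀ i, (b i).IsDary

/-- Root-preserving isomorphism of (unordered) rooted trees. -/
inductive Iso : RTree d → RTree d → Prop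
  | nil : Iso nil nil
  | leaf : Iso leaf leaf
  | node {a b : Fin d → RTree d} (σ : Equiv.Perm (Fin d)) (h : ∀ i, Iso (a i) (b (σ i))) :
      Iso (node a) (node b)

theorem Iso.refl : ∀ t : RTree d, Iso t t
  | .nil => .nil
  | .leaf => .leaf
  | .node b => .node 1 fun i => Iso.refl (b i)

theorem Iso.symm {s t : RTree d} (h : Iso s t) : Iso t s := by
  induction h with
  | nil => exact .nil
  | leaf => exact .leaf
  | @node a b σ _ ih =>
    refine .node σ.symm fun i => ?_
    have := ih (σ.symm i)
    rwa [Equiv.apply_symm_apply] at this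

theorem Iso.trans {s t u : RTree d} (h : Iso s t) (h' : Iso t u) : Iso s u := by
  induction h generalizing u with
  | nil => exact h'
  | leaf => exact h'
  | @node a b σ _ ih =>
    cases h' with
    | @node _ c τ h' => exact .node (σ.trans τ) fun i => ih i (h' (σ i))

/-- The type of leaves of a tree. -/
def Leaves : RTree d → Type
  | nil => Empty
  | leaf => Unit
  | node b => (i : Fin d) × (b i).Leaves

instance finite_leaves : ∀ t : RTree d, Finite t.Leaves
  | nil => inferInstanceAs (Finite Empty)
  | leaf => inferInstanceAs (Finite Unit)
  | node b =>
    have := fun i => finite_leaves (b i)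
    inferInstanceAs (Finite ((i : Fin d) × (b i).Leaves))

/-- The size `‖T‖` of a tree: its number of leaves. -/
noncomputable def numLeaves (t : RTree d) : ℕ := Nat.card t.Leaves

open Classical in
/-- Put a common root above the branches `b i`, but suppress that root if it would have only one
child (and discard it if it would have no child at all). -/
noncomputable def join (b : Fin d → RTree d) : RTree d :=
  if h : ∃! i, b i ≠ nil then b h.choose
  else if ∀ i, b i = nil then nil
  else node b

open Classical in
/-- The leaf-induced subtree: keep only the vertices above leaves in `S` and suppress every vertex
that is left with exactly one child. -/
noncomputable def induced : (t : RTree d) → Set t.Leaves → RTree d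
  | nil, _ => nil
  | leaf, S => if S.Nonempty then leaf else nil
  | node b, S => join fun i => (b i).induced {l : (b i).Leaves | (⟨i, l⟩ : (i : Fin d) × (b i).Leaves) ∈ S}

/-- `c(D, T)`: the number of sets of leaves of `T` that induce a tree isomorphic to `D`. -/
noncomputable def copies (D T : RTree d) : ℕ :=
  {S : Set T.Leaves | Iso (T.induced S) D}.ncard

/-- The density `γ(D, T)`. -/
noncomputable def density (D T : RTree d) : ℝ :=
  (copies D T : ℝ) / ((T.numLeaves).choose D.numLeaves : ℝ)

/-- The maximum of `γ(D, T)` over all `d`-ary trees `T` with `n` leaves. -/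
noncomputable def maxDensity (D : RTree d) (n : ℕ) : ℝ :=
  sSup {x : ℝ | ∃ T : RTree d, T.IsDary ∧ T.numLeaves = n ∧ x = density D T}

/-- The `d`-ary inducibility `I_d(D)`. -/
noncomputable def inducibility (D : RTree d) : ℝ :=
  Filter.limsup (fun n : ℕ => maxDensity D n) Filter.atTop

/-- The branches `D_1, …, D_d` of a tree, padded by empty trees. -/
def branch : RTree d → Fin d → RTree d
  | nil, _ => nil
  | leaf, _ => nil
  | node b, i => b i

/-- The equivalence relation `∼_D` on the permutations of the branch indices. -/
def permSetoid (D : RTree d) : Setoid (Equiv.Perm (Fin d)) where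
  r π π' := ∀ j, Iso (D.branch (π j)) (D.branch (π' j))
  iseqv :=
    { refl := fun _ _ => Iso.refl _
      symm := fun h j => (h j).symm
      trans := fun h h' j => (h j).trans (h' j) }

/-- `|M(D)|`: the number of equivalence classes of `∼_D`. -/
noncomputable def cardM (D : RTree d) : ℕ := Nat.card (Quotient D.permSetoid)

/-- `m_j`: the number of branches (empty ones included) with exactly `j` leaves. -/
noncomputable def numBranches (D : RTree d) (j : ℕ) : ℕ :=
  {i : Fin d | (D.branch i).numLeaves = j}.ncard

/-- The constant `|M(D)| ∏_{j ≥ 0} m_j! / d!` (almost all factors of the product are `0! = 1`). -/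
noncomputable def branchConst (D : RTree d) : ℝ :=
  (D.cardM : ℝ) * ((∏ᶠ j : ℕ, (D.numBranches j)! : ℕ) : ℝ) / (d ! : ℝ)

end RTree

/-! ### Isomorphism, leaf counts and induced subtrees. -/

namespace RTree

variable {d : ℕ}

/-! Let `k = ‖D‖`, let `D` have a root with branches `D_j` of sizes `k_j`, and let `K` be the
claimed bound. The core is an estimate without error term, `c(D,T) ≤ K ‖T‖^k / k!` for every finite
`d`-ary tree `T`; dividing by the binomial coefficient and letting `‖T‖ → ∞` gives the theorem.

The estimate is proved by induction on `T`, with `x_i = ‖T_i‖`. A copy of `D` lies in a single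
branch of `T`, or it distributes the branches of `D` over those of `T` (`copies_node_node`). Copies
of the first kind number at most `K ∑ x_i^k / k!` by induction. For the second kind, `c(D_j,T_i) ≤
I_d(D_j) x_i^{k_j} / k_j!`, which is exact for finite trees because blowing up the leaves of `T_i`
preserves the normalised count in the limit (`copies_le_inducibility_mul`).

A size vector comes from `∏ m_j!` permutations and a class from `d!/|M(D)|`, so each rearrangement
of the sizes is met by exactly `branchConst D` classes (`sum_quotient_eq_branchConst_mul`). The
resulting monomials are terms of the multinomial expansion of `(∑ x_i)^k / k!`. They differ from the
pure powers because `D` has two nonempty branches, so both kinds fit into one expansion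
(`sum_rearrangements_le`). -/

theorem Iso.eq_nil_iff {s t : RTree d} (h : Iso s t) : s = RTree.nil ↔ t = RTree.nil := by
  cases h <;> simp

@[simp] theorem iso_nil_iff {s : RTree d} : Iso s nil ↔ s = nil :=
  ⟨fun h => h.eq_nil_iff.2 rfl, fun h => h ▸ Iso.nil⟩

theorem numLeaves_nil : (nil : RTree d).numLeaves = 0 := by
  simp [numLeaves, Leaves]

theorem numLeaves_leaf : (leaf : RTree d).numLeaves = 1 := by
  simp [numLeaves, Leaves]

theorem numLeaves_node (b : Fin d → RTree d) : (node b).numLeaves = ∑ i, (b i).numLeaves :=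
  Nat.card_sigma

theorem Iso.numLeaves_eq {s t : RTree d} (h : Iso s t) : s.numLeaves = t.numLeaves := by
  induction h with
  | nil => rfl
  | leaf => rfl
  | @node a b σ _ ih =>
    simp only [numLeaves_node, ih]
    exact Equiv.sum_comp σ fun i => (b i).numLeaves

theorem join_of_forall_ne {c : Fin d → RTree d} {i : Fin d} (h : ∀ j, j ≠ i → c j = nil) :
    join c = c i := by
  by_cases hi : c i = nil
  · have h0 : ∀ j, c j = nil := fun j => by
      by_cases hj : j = i
      · rw [hj, hi]
      · exact h j hj
    have h1 : ¬ ∃! j, c j ≠ nil := fun ⟨j, hj, _⟩ => hj (h0 j)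
    rw [join, dif_neg h1, if_pos h0, hi]
  · have h1 : ∃! j, c j ≠ nil := ⟨i, hi, fun j hj => by_contra fun hne => hj (h j hne)⟩
    rw [join, dif_pos h1, h1.unique h1.choose_spec.1 hi]

theorem join_of_two {c : Fin d → RTree d} {i j : Fin d} (hij : i ≠ j) (hi : c i ≠ nil)
    (hj : c j ≠ nil) : join c = node c := by
  have h1 : ¬ ∃! j, c j ≠ nil := fun h => hij (h.unique hi hj)
  have h2 : ¬ ∀ j, c j = nil := fun h => hi (h i)
  rw [join, dif_neg h1, if_neg h2]

/-- Either at most one branch is nonempty, or two different branches are. -/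
theorem at_most_one_or_two (hd : 0 < d) (c : Fin d → RTree d) :
    (∃ i, ∀ j, j ≠ i → c j = nil) ∨ ∃ i j, i ≠ j ∧ c i ≠ nil ∧ c j ≠ nil := by
  by_cases h : ∃ i, c i ≠ nil
  · obtain ⟨i, hi⟩ := h
    by_cases h' : ∃ j, j ≠ i ∧ c j ≠ nil
    · obtain ⟨j, hj, hj'⟩ := h'
      exact .inr ⟨i, j, hj.symm, hi, hj'⟩
    · push Not at h'
      exact .inl ⟨i, h'⟩
  · push Not at h
    exact .inl ⟨⟨0, hd⟩, fun j _ => h j⟩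

theorem numLeaves_join (hd : 0 < d) (c : Fin d → RTree d) :
    (join c).numLeaves = ∑ i, (c i).numLeaves := by
  obtain ⟨i, h⟩ | ⟨i, j, hij, hi, hj⟩ := at_most_one_or_two hd c
  · rw [join_of_forall_ne h, Finset.sum_eq_single i]
    · intro j _ hj
      rw [h j hj, numLeaves_nil]
    · simp
  · rw [join_of_two hij hi hj, numLeaves_node]

/-- A set of leaves of a tree with branches `b i` is a family of sets of leaves of the `b i`. -/
def leafSetEquiv (b : Fin d → RTree d) : (∀ i, Set (b i).Leaves) ≃ Set (node b).Leaves where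
  toFun f := {x : (i : Fin d) × (b i).Leaves | x.2 ∈ f x.1}
  invFun S i := {l | (⟨i, l⟩ : (i : Fin d) × (b i).Leaves) ∈ S}
  left_inv _ := rfl
  right_inv _ := rfl

theorem induced_leafSetEquiv (b : Fin d → RTree d) (f : ∀ i, Set (b i).Leaves) :
    (node b).induced (leafSetEquiv b f) = join fun i => (b i).induced (f i) := rfl

theorem ncard_leafSetEquiv (b : Fin d → RTree d) (f : ∀ i, Set (b i).Leaves) :
    (leafSetEquiv b f).ncard = ∑ i, (f i).ncard := by
  have e : (leafSetEquiv b f) ≃ (i : Fin d) × f i :=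
    { toFun := fun x => ⟨x.1.1, x.1.2, x.2⟩
      invFun := fun y => ⟨⟨y.1, y.2.1⟩, y.2.2⟩
      left_inv := fun _ => rfl
      right_inv := fun _ => rfl }
  rw [← Nat.card_coe_set_eq, Nat.card_congr e, Nat.card_sigma]
  simp only [Nat.card_coe_set_eq]

theorem numLeaves_induced (hd : 0 < d) (t : RTree d) (S : Set t.Leaves) :
    (t.induced S).numLeaves = S.ncard := by
  induction t with
  | nil =>
    have : S = ∅ := Set.eq_empty_of_forall_notMem fun x => Empty.elim x
    rw [this, Set.ncard_empty]
    exact numLeaves_nil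
  | leaf =>
    rcases S.eq_empty_or_nonempty with rfl | h
    · simp [induced, numLeaves_nil]
    · rw [induced, if_pos h, numLeaves_leaf]
      obtain ⟨x, hx⟩ := h
      rw [Set.eq_singleton_iff_unique_mem.2 ⟨hx, fun _ _ => rfl⟩, Set.ncard_singleton]
  | node b ih =>
    obtain ⟨f, rfl⟩ := (leafSetEquiv b).surjective S
    rw [induced_leafSetEquiv, numLeaves_join hd, ncard_leafSetEquiv]
    exact Finset.sum_congr rfl fun i _ => ih i (f i)

theorem IsDary.eq_nil_of_numLeaves {t : RTree d} (ht : t.IsDary) (h : t.numLeaves = 0) :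
    t = nil := by
  induction t with
  | nil => rfl
  | leaf => simp [numLeaves_leaf] at h
  | node b ih =>
    exfalso
    rw [numLeaves_node, Finset.sum_eq_zero_iff] at h
    have h0 : {i | b i ≠ nil} = ∅ := by
      ext i
      simpa using ih i (ht.2 i) (h i (Finset.mem_univ i))
    have := ht.1
    rw [h0, Set.ncard_empty] at this
    omega

theorem isDary_join (hd : 0 < d) {c : Fin d → RTree d} (h : ∀ i, (c i).IsDary) :
    (join c).IsDary := by
  obtain ⟨i, h'⟩ | ⟨i, j, hij, hi, hj⟩ := at_most_one_or_two hd c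
  · rw [join_of_forall_ne h']
    exact h i
  · rw [join_of_two hij hi hj]
    refine ⟨?_, h⟩
    rw [← Set.ncard_pair hij]
    exact Set.ncard_le_ncard (by rintro x (rfl | rfl) <;> assumption)

theorem isDary_induced (hd : 0 < d) (t : RTree d) (S : Set t.Leaves) : (t.induced S).IsDary := by
  induction t with
  | nil => trivial
  | leaf => rw [induced]; split <;> trivial
  | node b ih => exact isDary_join hd fun i => ih i _

theorem induced_eq_nil_iff (hd : 0 < d) {t : RTree d} {S : Set t.Leaves} :
    t.induced S = nil ↔ S = ∅ := by
  rw [← Set.ncard_eq_zero, ← numLeaves_induced hd]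
  exact ⟨fun h => h ▸ numLeaves_nil, (isDary_induced hd t S).eq_nil_of_numLeaves⟩

/-! ### Counting copies and the recursion over branches. -/

theorem copies_le_choose (hd : 0 < d) (D T : RTree d) :
    copies D T ≤ T.numLeaves.choose D.numLeaves := by
  classical
  have := Fintype.ofFinite T.Leaves
  have h : {S : Set T.Leaves | Iso (T.induced S) D} ⊆
      (fun s : Finset T.Leaves => (s : Set T.Leaves)) ''
        (Finset.univ.powersetCard D.numLeaves : Finset (Finset T.Leaves)) := by
    intro S hS
    have hS : Iso (T.induced S) D := hS
    refine ⟨S.toFinset, ?_, by simp⟩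
    rw [Finset.mem_coe, Finset.mem_powersetCard, ← hS.numLeaves_eq, numLeaves_induced hd,
      Set.ncard_eq_toFinset_card']
    exact ⟨Finset.subset_univ _, rfl⟩
  calc copies D T ≤ _ := Set.ncard_le_ncard h (Set.toFinite _)
    _ ≤ _ := Set.ncard_image_le (Finset.finite_toSet _)
    _ = _ := by
      rw [Set.ncard_coe_finset, Finset.card_powersetCard, Finset.card_univ,
        ← Nat.card_eq_fintype_card, ← numLeaves]

theorem copies_nil_left (hd : 0 < d) (T : RTree d) : copies nil T = 1 := by
  have : {S : Set T.Leaves | Iso (T.induced S) nil} = {∅} := by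
    ext S
    simp [induced_eq_nil_iff hd]
  rw [copies, this, Set.ncard_singleton]

theorem iso_leaf_iff {s : RTree d} (hs : s.IsDary) : Iso s leaf ↔ s.numLeaves = 1 := by
  refine ⟨fun h => h.numLeaves_eq.trans numLeaves_leaf, fun h => ?_⟩
  cases s with
  | nil => simp [numLeaves_nil] at h
  | leaf => exact .leaf
  | node b =>
    exfalso
    obtain ⟨i, j, hi, hj, hij⟩ := (Set.one_lt_ncard_iff).1 (lt_of_lt_of_le one_lt_two hs.1)
    have h1 : (b i).numLeaves ≠ 0 := fun h => hi ((hs.2 i).eq_nil_of_numLeaves h)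
    have h2 : (b j).numLeaves ≠ 0 := fun h => hj ((hs.2 j).eq_nil_of_numLeaves h)
    have := Finset.add_le_sum (f := fun i => (b i).numLeaves) (fun _ _ => Nat.zero_le _)
      (Finset.mem_univ i) (Finset.mem_univ j) hij
    rw [← numLeaves_node, h] at this
    omega

theorem copies_leaf_left (hd : 0 < d) (T : RTree d) : copies leaf T = T.numLeaves := by
  have : {S : Set T.Leaves | Iso (T.induced S) leaf} = Set.range fun x => {x} := by
    ext S
    change Iso (T.induced S) leaf ↔ _
    rw [iso_leaf_iff (isDary_induced hd T S), numLeaves_induced hd, Set.ncard_eq_one]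
    simp [eq_comm]
  rw [copies, this, ← Nat.card_coe_set_eq, Nat.card_range_of_injective Set.singleton_injective,
    numLeaves]

theorem copies_node_leaf (a : Fin d → RTree d) : copies (node a) leaf = 0 := by
  have : {S : Set (leaf : RTree d).Leaves | Iso (induced leaf S) (node a)} = ∅ := by
    ext S
    simp only [Set.mem_ofPred_eq, Set.mem_empty_iff_false, iff_false, induced]
    split <;> rintro ⟨⟩
  rw [copies, this, Set.ncard_empty]

theorem copies_node_nil (a : Fin d → RTree d) : copies (node a) nil = 0 := by
  have : {S : Set (nil : RTree d).Leaves | Iso (induced nil S) (node a)} = ∅ := by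
    ext S
    simp only [Set.mem_ofPred_eq, Set.mem_empty_iff_false, iff_false, induced]
    rintro ⟨⟩
  rw [copies, this, Set.ncard_empty]

noncomputable instance (D : RTree d) : Fintype (Quotient D.permSetoid) := Fintype.ofFinite _

/-- A set of leaves inducing `D` either lies in a single branch, or its traces on the branches
induce the branches of `D` in some order. -/
theorem copies_node_node (hd : 0 < d) {a : Fin d → RTree d} (ha : (node a).IsDary)
    (b : Fin d → RTree d) :
    copies (node a) (node b) = ∑ i, copies (node a) (b i) +
      ∑ q : Quotient (node a).permSetoid, ∏ i, copies (a (q.out i)) (b i) := by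
  classical
  -- The left summand encodes the copies inside one branch, the right one those spread over the
  -- branches. The permutation is recorded only up to equivalence, so that no set is counted twice.
  let F : ((i : Fin d) × {S : Set (b i).Leaves | Iso ((b i).induced S) (node a)}) ⊕
      ((q : Quotient (node a).permSetoid) × ∀ i, {S : Set (b i).Leaves |
        Iso ((b i).induced S) (a (q.out i))}) → ∀ i, Set (b i).Leaves :=
    Sum.elim (fun x => Function.update (fun _ => ∅) x.1 x.2.1) (fun x i => (x.2 i).1)
  obtain ⟨i₀, j₀, hi₀, hj₀, hij₀⟩ := (Set.one_lt_ncard_iff).1 (lt_of_lt_of_le one_lt_two ha.1)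
  -- Two nonempty traces distinguish a spread copy from one in a single branch, and they prevent
  -- `join` from suppressing the root.
  have two (q : Quotient (node a).permSetoid) (f : ∀ i, Set (b i).Leaves)
      (hf : ∀ i, Iso ((b i).induced (f i)) (a (q.out i))) :
      ∃ i j, i ≠ j ∧ (b i).induced (f i) ≠ nil ∧ (b j).induced (f j) ≠ nil := by
    refine ⟨q.out.symm i₀, q.out.symm j₀, by simpa using hij₀, ?_, ?_⟩
    · rw [Ne, (hf _).eq_nil_iff, Equiv.apply_symm_apply]
      exact hi₀
    · rw [Ne, (hf _).eq_nil_iff, Equiv.apply_symm_apply]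
      exact hj₀
  have hrange : {S : Set (node b).Leaves | Iso ((node b).induced S) (node a)} =
      leafSetEquiv b '' Set.range F := by
    ext S
    obtain ⟨f, rfl⟩ := (leafSetEquiv b).surjective S
    rw [(leafSetEquiv b).injective.mem_set_image]
    simp only [Set.mem_ofPred_eq, induced_leafSetEquiv]
    constructor
    · intro h
      obtain ⟨i, h'⟩ | ⟨i, j, hij, hi, hj⟩ :=
        at_most_one_or_two hd fun i => (b i).induced (f i)
      · rw [join_of_forall_ne h'] at h
        refine ⟨.inl ⟨i, f i, h⟩, ?_⟩
        funext j
        by_cases hj : j = i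
        · subst hj
          simp [F]
        · simp [F, hj, (induced_eq_nil_iff hd).1 (h' j hj)]
      · rw [join_of_two hij hi hj] at h
        cases h with
        | node σ h =>
          refine ⟨.inr ⟨Quotient.mk _ σ, fun i => ⟨f i, (h i).trans ?_⟩⟩, rfl⟩
          exact ((node a).permSetoid.symm (Quotient.mk_out σ)) i
    · rintro ⟨x | x, rfl⟩
      · rw [join_of_forall_ne (i := x.1)]
        · have := x.2.2
          simp only [Set.mem_ofPred_eq] at this
          simpa only [F, Sum.elim_inl, Function.update_self] using this
        · intro j hj
          simp [F, hj, induced_eq_nil_iff hd]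
      · obtain ⟨i, j, hij, hi, hj⟩ := two x.1 (fun i => (x.2 i).1) fun i => (x.2 i).2
        exact (join_of_two (c := fun i => (b i).induced (F (.inr x) i)) hij hi hj) ▸
          Iso.node x.1.out fun i => (x.2 i).2
  have hinj : Function.Injective F := by
    have single (x : (i : Fin d) × {S : Set (b i).Leaves | Iso ((b i).induced S) (node a)})
        (j : Fin d) (hj : (b j).induced (F (.inl x) j) ≠ nil) : j = x.1 := by
      by_contra h
      exact hj (by simp [F, h, induced_eq_nil_iff hd])
    have single' (x : (i : Fin d) × {S : Set (b i).Leaves | Iso ((b i).induced S) (node a)}) :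
        (b x.1).induced (F (.inl x) x.1) ≠ nil := by
      have := x.2.2
      simp only [Set.mem_ofPred_eq] at this
      simp only [F, Sum.elim_inl, Function.update_self, Ne, this.eq_nil_iff]
      simp
    have inlr (x y) (h : F (.inl x) = F (.inr y)) : False := by
      obtain ⟨i, j, hij, hi, hj⟩ := two y.1 (fun i => (y.2 i).1) fun i => (y.2 i).2
      change (b i).induced (F (.inr y) i) ≠ nil at hi
      change (b j).induced (F (.inr y) j) ≠ nil at hj
      rw [← h] at hi hj
      exact hij ((single x i hi).trans (single x j hj).symm)
    rintro (x | x) (y | y) h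
    · have h1 := single' x
      rw [h] at h1
      have h2 := single y _ h1
      obtain ⟨i, S, hS⟩ := x
      obtain ⟨j, S', hS'⟩ := y
      obtain rfl : i = j := h2
      have := congrFun h i
      simp only [F, Sum.elim_inl, Function.update_self] at this
      subst this
      rfl
    · exact (inlr x y h).elim
    · exact (inlr y x h.symm).elim
    · obtain ⟨q, f⟩ := x
      obtain ⟨q', f'⟩ := y
      have h' : ∀ i, (f i).1 = (f' i).1 := congrFun h
      -- The traces determine the isomorphism type placed in each slot, hence the class of the
      -- permutation.
      obtain rfl : q = q' := by
        rw [← q.out_eq, ← q'.out_eq]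
        refine Quotient.sound fun i => ?_
        have h1 := (f i).2
        rw [h' i] at h1
        exact Iso.trans (Iso.symm h1) (f' i).2
      congr
      funext i
      exact Subtype.ext (h' i)
  rw [copies, hrange, Set.ncard_image_of_injective _ (leafSetEquiv b).injective,
    ← Nat.card_coe_set_eq, Nat.card_range_of_injective hinj, Nat.card_sum, Nat.card_sigma,
    Nat.card_sigma]
  simp only [Nat.card_pi]
  rfl

/-! ### Blow-ups. -/

/-- Replace every leaf of a tree by a copy of `B`. -/
def blowUp (B : RTree d) : RTree d → RTree d
  | nil => nil
  | leaf => B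
  | node b => node fun i => blowUp B (b i)

theorem numLeaves_blowUp (B T : RTree d) :
    (blowUp B T).numLeaves = T.numLeaves * B.numLeaves := by
  induction T with
  | nil => simp [blowUp, numLeaves_nil]
  | leaf => simp [blowUp, numLeaves_leaf]
  | node b ih => simp only [blowUp, numLeaves_node, ih, Finset.sum_mul]

theorem blowUp_ne_nil {B T : RTree d} (hB : B ≠ nil) (hT : T ≠ nil) : blowUp B T ≠ nil := by
  cases T with
  | nil => exact absurd rfl hT
  | leaf => exact hB
  | node b => simp [blowUp]

theorem isDary_blowUp {B T : RTree d} (hB : B.IsDary) (hB' : B ≠ nil) (hT : T.IsDary) :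
    (blowUp B T).IsDary := by
  induction T with
  | nil => trivial
  | leaf => exact hB
  | node b ih =>
    refine ⟨hT.1.trans (Set.ncard_le_ncard fun i hi => blowUp_ne_nil hB' hi), fun i => ?_⟩
    exact ih i (hT.2 i)

/-- In a copy of `D` in `T`, each of the `‖D‖` leaves can be replaced by any leaf of the copy of `B`
put there. The recursion for `copies` turns this into an induction on `T`. -/
theorem copies_mul_pow_le_copies_blowUp (hd : 0 < d) {D : RTree d} (hD : D.IsDary)
    (B T : RTree d) :
    copies D T * B.numLeaves ^ D.numLeaves ≤ copies D (blowUp B T) := by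
  induction T generalizing D with
  | nil =>
    cases D with
    | nil => simp [copies_nil_left hd, numLeaves_nil]
    | leaf => simp [copies_leaf_left hd, numLeaves_nil]
    | node a => simp [copies_node_nil]
  | leaf =>
    cases D with
    | nil => simp [copies_nil_left hd, numLeaves_nil]
    | leaf => simp [copies_leaf_left hd, numLeaves_leaf, blowUp]
    | node a => simp [copies_node_leaf]
  | node b ih =>
    cases D with
    | nil => simp [copies_nil_left hd, numLeaves_nil]
    | leaf => simp [copies_leaf_left hd, numLeaves_leaf, numLeaves_blowUp]
    | node a =>
      rw [blowUp, copies_node_node hd hD, copies_node_node hd hD, add_mul, Finset.sum_mul,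
        Finset.sum_mul]
      refine add_le_add (Finset.sum_le_sum fun i _ => ih i hD) (Finset.sum_le_sum fun q _ => ?_)
      rw [numLeaves_node, ← Equiv.sum_comp q.out, ← Finset.prod_pow_eq_pow_sum,
        ← Finset.prod_mul_distrib]
      exact Finset.prod_le_prod' fun i _ => ih i (hD.2 _)

/-- Guarantees that `maxDensity` is a supremum over a nonempty set. The witnesses are caterpillars.
-/
theorem exists_isDary_numLeaves (hd : 2 ≤ d) (n : ℕ) :
    ∃ T : RTree d, T.IsDary ∧ T.numLeaves = n := by
  induction n with
  | zero => exact ⟨nil, trivial, numLeaves_nil⟩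
  | succ n ih =>
    rcases n.eq_zero_or_pos with rfl | hn
    · exact ⟨leaf, trivial, numLeaves_leaf⟩
    obtain ⟨B, hB, rfl⟩ := ih
    let i₀ : Fin d := ⟨0, by omega⟩
    let i₁ : Fin d := ⟨1, by omega⟩
    have hne : i₀ ≠ i₁ := by simp [i₀, i₁]
    have hB' : B ≠ nil := by
      rintro rfl
      simp [numLeaves_nil] at hn
    refine ⟨node fun i => if i = i₀ then B else if i = i₁ then leaf else nil, ⟨?_, ?_⟩, ?_⟩
    · rw [← Set.ncard_pair hne]
      refine Set.ncard_le_ncard ?_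
      rintro x (rfl | rfl)
      · simpa using hB'
      · simp [hne.symm]
    · intro i
      dsimp only
      split_ifs <;> trivial
    · have : ∀ i, (if i = i₀ then B else if i = i₁ then leaf else nil).numLeaves =
          (if i = i₀ then B.numLeaves else 0) + if i = i₁ then 1 else 0 := by
        intro i
        split_ifs with h h' h'
        · exact absurd (h.symm.trans h') hne
        · rfl
        · simp [numLeaves_leaf]
        · exact numLeaves_nil
      simp [numLeaves_node, this, Finset.sum_add_distrib]

/-! ### Densities and inducibility. -/

theorem density_nonneg (D T : RTree d) : 0 ≤ density D T := by
  unfold density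
  positivity

theorem density_le_one (hd : 0 < d) (D T : RTree d) : density D T ≤ 1 :=
  div_le_one_of_le₀ (mod_cast copies_le_choose hd D T) (Nat.cast_nonneg _)

theorem density_le_maxDensity (hd : 0 < d) (D : RTree d) {T : RTree d} (hT : T.IsDary) :
    density D T ≤ maxDensity D T.numLeaves := by
  refine le_csSup ⟨1, ?_⟩ ⟨T, hT, rfl, rfl⟩
  rintro _ ⟨T, _, _, rfl⟩
  exact density_le_one hd D T

theorem maxDensity_le (hd : 2 ≤ d) {D : RTree d} {n : ℕ} {x : ℝ}
    (h : ∀ T : RTree d, T.IsDary → T.numLeaves = n → density D T ≤ x) : maxDensity D n ≤ x := by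
  obtain ⟨T, hT, hn⟩ := exists_isDary_numLeaves hd n
  refine csSup_le ⟨_, T, hT, hn, rfl⟩ ?_
  rintro _ ⟨T, hT, hn, rfl⟩
  exact h T hT hn

theorem maxDensity_le_one (hd : 2 ≤ d) (D : RTree d) (n : ℕ) : maxDensity D n ≤ 1 :=
  maxDensity_le hd fun T _ _ => density_le_one (by omega) D T

theorem maxDensity_nonneg (D : RTree d) (n : ℕ) : 0 ≤ maxDensity D n :=
  Real.sSup_nonneg (by rintro _ ⟨T, _, _, rfl⟩; exact density_nonneg D T)

/-- A real `limsup` is only meaningful for bounded sequences; this bound and the next one supply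
that. -/
theorem isBoundedUnder_maxDensity (hd : 2 ≤ d) (D : RTree d) (l : Filter ℕ) :
    l.IsBoundedUnder (· ≤ ·) (maxDensity D) :=
  Filter.isBoundedUnder_of ⟨1, maxDensity_le_one hd D⟩

theorem isCoboundedUnder_maxDensity (D : RTree d) (l : Filter ℕ) [l.NeBot] :
    l.IsCoboundedUnder (· ≤ ·) (maxDensity D) :=
  (Filter.isBoundedUnder_of ⟨0, maxDensity_nonneg D⟩ :
    l.IsBoundedUnder (· ≥ ·) (maxDensity D)).isCoboundedUnder_le

theorem inducibility_le_of_tendsto {D : RTree d} {u : ℕ → ℝ} {x : ℝ}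
    (hu : Filter.Tendsto u Filter.atTop (nhds x))
    (h : ∀ᶠ n in Filter.atTop, maxDensity D n ≤ u n) : D.inducibility ≤ x :=
  (Filter.limsup_le_limsup h (isCoboundedUnder_maxDensity D _) hu.isBoundedUnder_le).trans_eq
    hu.limsup_eq

theorem le_inducibility_of_tendsto (hd : 2 ≤ d) {D : RTree d} {p : ℕ → ℕ} {v : ℕ → ℝ} {x : ℝ}
    (hφ : Filter.Tendsto p Filter.atTop Filter.atTop)
    (hv : Filter.Tendsto v Filter.atTop (nhds x))
    (h : ∀ᶠ n in Filter.atTop, v n ≤ maxDensity D (p n)) : x ≤ D.inducibility := by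
  have h1 : Filter.atTop.IsBoundedUnder (· ≤ ·) (maxDensity D ∘ p) :=
    Filter.isBoundedUnder_of ⟨1, fun n => maxDensity_le_one hd D (p n)⟩
  calc x = Filter.limsup v Filter.atTop := hv.limsup_eq.symm
    _ ≤ Filter.limsup (maxDensity D ∘ p) Filter.atTop :=
      Filter.limsup_le_limsup h hv.isCoboundedUnder_le h1
    _ ≤ _ := Filter.Tendsto.limsup_comp_le_limsup hφ (isCoboundedUnder_maxDensity D _)
      (isBoundedUnder_maxDensity hd D _)

theorem inducibility_nonneg (hd : 2 ≤ d) (D : RTree d) : 0 ≤ D.inducibility :=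
  le_inducibility_of_tendsto hd Filter.tendsto_id tendsto_const_nhds
    (.of_forall (maxDensity_nonneg D))

theorem maxDensity_nil (hd : 2 ≤ d) (n : ℕ) : maxDensity (nil : RTree d) n = 1 := by
  refine le_antisymm (maxDensity_le_one hd _ n) ?_
  obtain ⟨T, hT, rfl⟩ := exists_isDary_numLeaves hd n
  refine le_trans (le_of_eq ?_) (density_le_maxDensity (by omega) nil hT)
  simp [density, copies_nil_left (show 0 < d by omega), numLeaves_nil]

theorem inducibility_nil (hd : 2 ≤ d) : (nil : RTree d).inducibility = 1 := by
  have : (fun n => maxDensity (nil : RTree d) n) = fun _ => 1 := funext (maxDensity_nil hd)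
  rw [inducibility, this, Filter.limsup_const]

theorem tendsto_pow_div_choose (k : ℕ) :
    Filter.Tendsto (fun n : ℕ => (n : ℝ) ^ k / k ! / (n.choose k : ℝ)) Filter.atTop (nhds 1) := by
  refine (Asymptotics.isEquivalent_iff_tendsto_one ?_).1 (isEquivalent_choose k).symm
  filter_upwards [Filter.eventually_ge_atTop k] with n hn
  exact_mod_cast (Nat.choose_pos hn).ne'

/-- The density of `D` in a finite tree, normalised by `n ^ k / k!` instead of a binomial
coefficient, never exceeds the inducibility of `D`. -/
theorem copies_le_inducibility_mul (hd : 2 ≤ d) {D T : RTree d} (hD : D.IsDary) (hT : T.IsDary) :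
    (copies D T : ℝ) ≤ D.inducibility * ((T.numLeaves : ℝ) ^ D.numLeaves / D.numLeaves !) := by
  have hd0 : 0 < d := by omega
  rcases D.numLeaves.eq_zero_or_pos with hk | hk
  · rw [hD.eq_nil_of_numLeaves hk, copies_nil_left hd0, inducibility_nil hd, numLeaves_nil]
    simp
  rcases T.numLeaves.eq_zero_or_pos with hn | hn
  · have : copies D T = 0 := by
      have := copies_le_choose hd0 D T
      rwa [hn, Nat.choose_eq_zero_of_lt hk, Nat.le_zero] at this
    rw [this, Nat.cast_zero]
    exact mul_nonneg (inducibility_nonneg hd D) (by positivity)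
  have hn' : (0 : ℝ) < (T.numLeaves : ℝ) ^ D.numLeaves / D.numLeaves ! := by positivity
  rw [← div_le_iff₀ hn']
  -- The blow-ups of `T` by trees with `m` leaves have `‖T‖ * m` leaves. Along this subsequence
  -- their densities are bounded below by a sequence tending to the normalised count of `T`.
  have hφ : Filter.Tendsto (fun m => T.numLeaves * m) Filter.atTop Filter.atTop :=
    Filter.tendsto_id.const_mul_atTop' hn
  have hlim := ((tendsto_pow_div_choose D.numLeaves).comp hφ).const_mul
    ((copies D T : ℝ) / ((T.numLeaves : ℝ) ^ D.numLeaves / D.numLeaves !))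
  rw [mul_one] at hlim
  refine le_inducibility_of_tendsto hd hφ hlim ?_
  filter_upwards [Filter.eventually_gt_atTop 0] with m hm
  obtain ⟨B, hB, rfl⟩ := exists_isDary_numLeaves hd m
  have hB' : B ≠ nil := by
    rintro rfl
    simp [numLeaves_nil] at hm
  have h := density_le_maxDensity hd0 D (isDary_blowUp hB hB' hT)
  rw [numLeaves_blowUp] at h
  refine le_trans ?_ h
  have hc : (copies D T : ℝ) * (B.numLeaves : ℝ) ^ D.numLeaves ≤ copies D (blowUp B T) :=
    mod_cast copies_mul_pow_le_copies_blowUp hd0 hD B T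
  rw [density, numLeaves_blowUp, Function.comp_apply, ← mul_div_assoc]
  refine div_le_div_of_nonneg_right (le_trans (le_of_eq ?_) hc) (Nat.cast_nonneg _)
  have : (T.numLeaves : ℝ) ≠ 0 := by positivity
  push_cast
  field_simp
  ring

end RTree

/-! ### Rearrangements and the multinomial theorem. -/

/-- Among the maps `f ∘ π`, every one arises from equally many permutations `π`. -/
theorem card_filter_comp_perm_eq {ι α : Type*} [Fintype ι] [DecidableEq ι] [DecidableEq α]
    (f : ι → α) (σ : Equiv.Perm ι) :
    (Finset.univ.filter fun π : Equiv.Perm ι => f ∘ π = f ∘ σ).card =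
      (Finset.univ.filter fun π : Equiv.Perm ι => f ∘ π = f).card := by
  refine Finset.card_equiv (Equiv.mulRight σ⁻¹) fun π => ?_
  simp only [Finset.mem_filter, Finset.mem_univ, true_and, Equiv.coe_mulRight]
  constructor
  · intro h
    funext x
    simpa using congrFun h (σ⁻¹ x)
  · intro h
    funext x
    simpa using congrFun h (σ x)

/-- Summing over all permutations `π` a quantity that depends only on `f ∘ π`. -/
theorem sum_perm_comp {ι α : Type*} [Fintype ι] [DecidableEq ι] [DecidableEq α] (f : ι → α)
    (w : (ι → α) → ℝ) :
    ∑ π : Equiv.Perm ι, w (f ∘ π) =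
      (Finset.univ.filter fun π : Equiv.Perm ι => f ∘ π = f).card *
        ∑ v ∈ Finset.univ.image fun π : Equiv.Perm ι => f ∘ π, w v := by
  rw [← Finset.sum_fiberwise_of_maps_to (g := fun π : Equiv.Perm ι => f ∘ π)
    (t := Finset.univ.image fun π : Equiv.Perm ι => f ∘ π)
    (fun π _ => Finset.mem_image_of_mem _ (Finset.mem_univ π)), Finset.mul_sum]
  refine Finset.sum_congr rfl fun v hv => ?_
  obtain ⟨σ, -, rfl⟩ := Finset.mem_image.1 hv
  rw [← card_filter_comp_perm_eq f σ, ← nsmul_eq_mul]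
  refine Finset.sum_eq_card_nsmul fun π hπ => ?_
  rw [(Finset.mem_filter.1 hπ).2]

/-- The terms of the multinomial theorem that belong to the rearrangements of `κ`, together with
the pure powers, do not exceed the whole sum. -/
theorem sum_rearrangements_le {ι : Type*} [Fintype ι] [DecidableEq ι] (κ : ι → ℕ)
    {i₀ j₀ : ι} (hij : i₀ ≠ j₀) (hi : κ i₀ ≠ 0) (hj : κ j₀ ≠ 0) {x : ι → ℝ} (hx : ∀ i, 0 ≤ x i) :
    ∑ i, x i ^ (∑ j, κ j) / (∑ j, κ j)! +
      ∑ v ∈ Finset.univ.image fun π : Equiv.Perm ι => κ ∘ π, ∏ i, (x i ^ v i / (v i)!) ≤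
    (∑ i, x i) ^ (∑ j, κ j) / (∑ j, κ j)! := by
  set k := ∑ j, κ j with hk
  have hk0 : k ≠ 0 := fun h => hi (Finset.sum_eq_zero_iff.1 h i₀ (Finset.mem_univ _))
  have hmulti : (∑ i, x i) ^ k / k ! =
      ∑ v ∈ Finset.piAntidiag Finset.univ k, ∏ i, (x i ^ v i / (v i)!) := by
    rw [Finset.sum_pow_eq_sum_piAntidiag, Finset.sum_div]
    refine Finset.sum_congr rfl fun v hv => ?_
    have hv' : ∑ i, v i = k := (Finset.mem_piAntidiag.1 hv).1
    have hs := Nat.multinomial_spec Finset.univ v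
    rw [hv'] at hs
    have hs' : (∏ i, ((v i)! : ℝ)) * Nat.multinomial Finset.univ v = k ! := mod_cast hs
    have h0 : (∏ i, ((v i)! : ℝ)) ≠ 0 := Finset.prod_ne_zero_iff.2 fun i _ => by positivity
    have h1 : (k ! : ℝ) ≠ 0 := by positivity
    rw [Finset.prod_div_distrib, div_eq_div_iff h1 h0, ← hs']
    ring
  have hpure : ∑ i, x i ^ k / k ! =
      ∑ v ∈ Finset.univ.image fun i : ι => Pi.single i k, ∏ i, (x i ^ v i / (v i)!) := by
    rw [Finset.sum_image]
    · refine Finset.sum_congr rfl fun i _ => ?_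
      rw [Finset.prod_eq_single i]
      · simp
      · intro j _ hj
        simp [hj]
      · simp
    · intro i _ j _ h
      by_contra hne
      have := congrFun h i
      simp [hne, hk0] at this
  have hdisj : Disjoint (Finset.univ.image fun i : ι => (Pi.single i k : ι → ℕ))
      (Finset.univ.image fun π : Equiv.Perm ι => κ ∘ π) := by
    rw [Finset.disjoint_left]
    intro v h1 h2
    obtain ⟨i, -, rfl⟩ := Finset.mem_image.1 h1
    obtain ⟨π, -, h⟩ := Finset.mem_image.1 h2
    -- If `κ ∘ π` is a pure power exponent, then `κ` is supported at a single point, contrary to `κ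
    -- i₀, κ j₀ ≠ 0`.
    have key : ∀ l, κ l ≠ 0 → l = π i := by
      intro l hl
      by_contra hne
      have := congrFun h (π.symm l)
      rw [Pi.single_eq_of_ne (by rwa [Ne, Equiv.symm_apply_eq])] at this
      simp [hl] at this
    exact hij ((key _ hi).trans (key _ hj).symm)
  rw [hmulti, hpure, ← Finset.sum_union hdisj]
  refine Finset.sum_le_sum_of_subset_of_nonneg (Finset.union_subset ?_ ?_) fun v _ _ =>
    Finset.prod_nonneg fun i _ => div_nonneg (pow_nonneg (hx i) _) (Nat.cast_nonneg _)
  · intro v hv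
    obtain ⟨i, -, rfl⟩ := Finset.mem_image.1 hv
    simp
  · intro v hv
    obtain ⟨π, -, rfl⟩ := Finset.mem_image.1 hv
    simp [hk, Equiv.sum_comp π κ]

/-! ### The constant `branchConst`. -/

namespace RTree

variable {d : ℕ}

open Classical in
/-- The number of permutations of the branches that preserve their isomorphism types. -/
noncomputable def cardStab (D : RTree d) : ℕ :=
  (Finset.univ.filter fun π : Equiv.Perm (Fin d) =>
    ∀ j, Iso (D.branch (π j)) (D.branch j)).card

theorem cardStab_pos (D : RTree d) : 0 < D.cardStab :=
  Finset.card_pos.2 ⟨1, by simp [Iso.refl]⟩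

/-- Summing over all permutations a quantity that depends only on the class of a permutation. -/
theorem sum_perm_eq_cardStab_mul (D : RTree d) (w : Equiv.Perm (Fin d) → ℝ)
    (hw : ∀ π π', D.permSetoid π π' → w π = w π') :
    ∑ π, w π = D.cardStab * ∑ q : Quotient D.permSetoid, w q.out := by
  classical
  rw [← Finset.sum_fiberwise_of_maps_to (g := fun π => Quotient.mk D.permSetoid π)
    (t := Finset.univ) (fun _ _ => Finset.mem_univ _), Finset.mul_sum]
  refine Finset.sum_congr rfl fun q _ => ?_
  have hcard : (Finset.univ.filter fun π => Quotient.mk D.permSetoid π = q).card =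
      D.cardStab := by
    refine Finset.card_equiv (Equiv.mulRight q.out⁻¹) fun π => ?_
    simp only [Finset.mem_filter, Finset.mem_univ, true_and, Equiv.coe_mulRight]
    rw [← Quotient.out_eq q, Quotient.eq, Quotient.out_eq]
    constructor
    · intro h j
      simpa using h (q.out⁻¹ j)
    · intro h j
      simpa using h (q.out j)
  rw [← hcard, ← nsmul_eq_mul]
  refine Finset.sum_eq_card_nsmul fun π hπ => hw _ _ ?_
  exact Quotient.exact ((Finset.mem_filter.1 hπ).2.trans q.out_eq.symm)

/-- All classes have the same size `cardStab`; this is the sum of the constant `1` over all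
permutations. -/
theorem cardStab_mul_cardM (D : RTree d) : D.cardStab * D.cardM = d ! := by
  have := sum_perm_eq_cardStab_mul D (fun _ => 1) fun _ _ _ => rfl
  simp only [Finset.sum_const, Finset.card_univ, Fintype.card_perm, Fintype.card_fin,
    nsmul_eq_mul, mul_one] at this
  rw [cardM, Nat.card_eq_fintype_card]
  exact_mod_cast this.symm

/-- A permutation preserving sizes permutes each set of equally large branches independently. -/
theorem finprod_factorial_numBranches (D : RTree d) :
    ∏ᶠ j : ℕ, (D.numBranches j)! = (Finset.univ.filter fun π : Equiv.Perm (Fin d) =>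
      (fun i => (D.branch i).numLeaves) ∘ π = fun i => (D.branch i).numLeaves).card := by
  classical
  have h := DomMulAct.stabilizer_card' fun i => (D.branch i).numLeaves
  rw [Fintype.card_subtype] at h
  rw [h, finprod_eq_prod_of_mulSupport_subset
    (s := Finset.univ.image fun i => (D.branch i).numLeaves)]
  · refine Finset.prod_congr rfl fun j _ => ?_
    rw [numBranches, ← Nat.card_coe_set_eq, ← Nat.card_eq_fintype_card]
    rfl
  · intro j hj
    by_contra hj'
    refine hj ?_
    have : {i : Fin d | (D.branch i).numLeaves = j} = ∅ := by
      refine Set.eq_empty_of_forall_notMem fun i hi => hj' ?_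
      exact Finset.mem_coe.2 (Finset.mem_image.2 ⟨i, Finset.mem_univ i, hi⟩)
    change (D.numBranches j)! = 1
    rw [numBranches, this, Set.ncard_empty, Nat.factorial_zero]

theorem branchConst_nonneg (D : RTree d) : 0 ≤ D.branchConst := by
  unfold branchConst
  positivity

/-- Summing over the classes of permutations a quantity that depends only on the sizes of the
permuted branches. -/
theorem sum_quotient_eq_branchConst_mul (D : RTree d) (w : (Fin d → ℕ) → ℝ) :
    ∑ q : Quotient D.permSetoid, w ((fun i => (D.branch i).numLeaves) ∘ q.out) =
      D.branchConst * ∑ v ∈ Finset.univ.image fun π : Equiv.Perm (Fin d) =>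
        (fun i => (D.branch i).numLeaves) ∘ π, w v := by
  have h1 := sum_perm_comp (fun i => (D.branch i).numLeaves) w
  rw [sum_perm_eq_cardStab_mul D (fun π => w ((fun i => (D.branch i).numLeaves) ∘ π))
    (fun π π' h => congrArg w (funext fun j => (h j).numLeaves_eq)),
    ← finprod_factorial_numBranches] at h1
  have h2 : (D.cardStab : ℝ) * D.cardM = d ! := mod_cast cardStab_mul_cardM D
  have h3 : (D.cardStab : ℝ) ≠ 0 := mod_cast (cardStab_pos D).ne'
  have h4 : (D.cardM : ℝ) ≠ 0 := fun h => by
    rw [h, mul_zero] at h2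
    exact Nat.factorial_ne_zero d (mod_cast h2.symm)
  refine mul_left_cancel₀ h3 (h1.trans ?_)
  rw [branchConst, ← h2]
  field_simp

/-- Under this hypothesis preserving sizes is the same as preserving isomorphism types, so `∏ m_j!`
equals `cardStab`. -/
theorem branchConst_eq_one {D : RTree d} (h : ∀ i j : Fin d,
    (D.branch i).numLeaves = (D.branch j).numLeaves → Iso (D.branch i) (D.branch j)) :
    D.branchConst = 1 := by
  classical
  have hs : ∏ᶠ j : ℕ, (D.numBranches j)! = D.cardStab := by
    rw [finprod_factorial_numBranches, cardStab]
    congr 1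
    ext π
    simp only [Finset.mem_filter, Finset.mem_univ, true_and, funext_iff, Function.comp_apply]
    exact forall_congr' fun j => ⟨h _ _, Iso.numLeaves_eq⟩
  rw [branchConst, hs, div_eq_one_iff_eq (by positivity), mul_comm]
  exact_mod_cast cardStab_mul_cardM D

/-! ### The bound on copies and on inducibility. -/

/-- The bound on the number of copies that proves the bound on the inducibility. -/
theorem copies_le_branchConst_mul (hd : 2 ≤ d) {a : Fin d → RTree d} (ha : (node a).IsDary)
    {T : RTree d} (hT : T.IsDary) :
    (copies (node a) T : ℝ) ≤ (node a).branchConst * (∏ i, (a i).inducibility) *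
      ((T.numLeaves : ℝ) ^ (node a).numLeaves / (node a).numLeaves !) := by
  have hI : 0 ≤ ∏ i, (a i).inducibility :=
    Finset.prod_nonneg fun i _ => inducibility_nonneg hd (a i)
  have hK := mul_nonneg (branchConst_nonneg (node a)) hI
  induction T with
  | nil =>
    rw [copies_node_nil, Nat.cast_zero]
    positivity
  | leaf =>
    rw [copies_node_leaf, Nat.cast_zero]
    positivity
  | node b ih =>
    obtain ⟨i₀, j₀, hi₀, hj₀, hij₀⟩ := (Set.one_lt_ncard_iff).1 (lt_of_lt_of_le one_lt_two ha.1)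
    have hne {i : Fin d} (hi : a i ≠ nil) : (a i).numLeaves ≠ 0 :=
      fun h => hi ((ha.2 i).eq_nil_of_numLeaves h)
    have hq : ∑ q : Quotient (node a).permSetoid,
        ∏ i, (copies (a (q.out i)) (b i) : ℝ) ≤
        (node a).branchConst * (∏ i, (a i).inducibility) *
          ∑ v ∈ Finset.univ.image fun π : Equiv.Perm (Fin d) => (fun i => (a i).numLeaves) ∘ π,
            ∏ i, (((b i).numLeaves : ℝ) ^ v i / (v i)!) := by
      have h := sum_quotient_eq_branchConst_mul (node a)
        fun v => ∏ i, (((b i).numLeaves : ℝ) ^ v i / (v i)!)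
      simp only [branch] at h
      -- The product of the inducibilities does not depend on the order of the branches, so it
      -- factors out of the sum over classes.
      rw [mul_comm (branchConst _), mul_assoc, ← h, Finset.mul_sum]
      refine Finset.sum_le_sum fun q _ => ?_
      rw [← Equiv.prod_comp q.out fun i => (a i).inducibility, ← Finset.prod_mul_distrib]
      exact Finset.prod_le_prod (fun i _ => Nat.cast_nonneg _) fun i _ =>
        copies_le_inducibility_mul hd (ha.2 _) (hT.2 i)
    have hsum := sum_rearrangements_le (fun i => (a i).numLeaves) hij₀ (hne hi₀) (hne hj₀)
      (x := fun i => ((b i).numLeaves : ℝ)) fun i => Nat.cast_nonneg _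
    rw [← numLeaves_node, ← Nat.cast_sum, ← numLeaves_node] at hsum
    refine le_trans ?_ (mul_le_mul_of_nonneg_left hsum hK)
    rw [copies_node_node (by omega) ha, mul_add, Finset.mul_sum]
    push_cast
    exact add_le_add (Finset.sum_le_sum fun i _ => ih i (hT.2 i)) hq

theorem inducibility_node_le (hd : 2 ≤ d) {a : Fin d → RTree d} (ha : (node a).IsDary) :
    (node a).inducibility ≤ (node a).branchConst * ∏ i, (a i).inducibility := by
  have hlim := (tendsto_pow_div_choose (node a).numLeaves).const_mul
    ((node a).branchConst * ∏ i, (a i).inducibility)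
  rw [mul_one] at hlim
  refine inducibility_le_of_tendsto hlim (.of_forall fun n => maxDensity_le hd ?_)
  rintro T hT rfl
  rw [density, ← mul_div_assoc]
  exact div_le_div_of_nonneg_right (copies_le_branchConst_mul hd ha hT) (Nat.cast_nonneg _)

theorem inducibility_le_branchConst_mul (hd : 2 ≤ d) {D : RTree d} (hD : D.IsDary) :
    D.inducibility ≤ D.branchConst * ∏ i, (D.branch i).inducibility := by
  -- Needed for the single vertex, whose branches are all empty, so that the right-hand side is `1`.
  have hone : D.inducibility ≤ 1 :=
    inducibility_le_of_tendsto tendsto_const_nhds (.of_forall (maxDensity_le_one hd D))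
  cases D with
  | nil =>
    have hc : (nil : RTree d).branchConst = 1 := branchConst_eq_one fun _ _ _ => Iso.refl nil
    rw [hc]
    simp [branch, inducibility_nil hd]
  | leaf =>
    have hc : (leaf : RTree d).branchConst = 1 := branchConst_eq_one fun _ _ _ => Iso.refl nil
    rw [hc]
    simpa [branch, inducibility_nil hd] using hone
  | node a => exact inducibility_node_le hd hD

end RTree

theorem corollary4 (d : ℕ) (hd : 2 ≤ d) (D : RTree d) (hD : D.IsDary) :
    D.inducibility ≤ D.branchConst * ∏ i : Fin d, (D.branch i).inducibility ∧
    ((∀ i j : Fin d, (D.branch i).numLeaves = (D.branch j).numLeaves →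
        RTree.Iso (D.branch i) (D.branch j)) →
      D.branchConst = 1 ∧
      D.inducibility ≤ ∏ i : Fin d, (D.branch i).inducibility) := by
  refine ⟨RTree.inducibility_le_branchConst_mul hd hD, fun h => ?_⟩
  have hc := RTree.branchConst_eq_one h
  refine ⟨hc, ?_⟩
  have := RTree.inducibility_le_branchConst_mul hd hD
  rwa [hc, one_mul] at this
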